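/- Let $g:[1,\infty)\to\mathbb{R}$ and let $h_1,s:(0,\infty)\to\mathbb{R}$ be measurable functions with $h_1\ge 0$ such that $$0<\int_0^\infty h_1(y)e^{-y}(1-e^{-y})\,dy<\infty \qquad\text{and}\qquad g(x)=\int_0^\infty h_1(y)\bigl(s(y)-e^{-xy}\bigr)\,dy\quad (x\ge 1),$$ where for every $x\ge 1$ the last integral converges as a Lebesgue integral. A random variable is called non-degenerate if it is not almost surely equal to a constant. Then: (i) There exists an integrable non-degenerate real random variable $X$, symmetric about its mean (i.e. $X-\mathbb{E}X$ and $-(X-\mathbb{E}X)$ have the same distribution), such that $\mathbb{E}\max(X_1,\dots,X_k)=g(k)$ for all $k=1,2,\dots$, where $X_1,\dots,X_k$ are independent copies of $X$, if and only if $$h_1\bigl(-\log(1-e^{-y})\bigr)=(e^y-1)\,h_1(y)\quad\text{for almost every } y\in(0,\infty).\qquad(*)$$ (ii) There exists an integrable non-degenerate real random variable $X$ such that $\mathbb{E}\bigl[\max(X_1,\dots,X_k)-\min(X_1,\dots,X_k)\bigr]=g(k)$ for all $k=1,2,\dots$, where $X_1,\dots,X_k$ are independent copies of $X$, if and only if $g(1)=0$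 and $(*)$ holds. -/

import Mathlib

open MeasureTheory ProbabilityTheory

/-- `g = I_s(h₁)`: the function `g : [1, ∞) → ℝ` admits an integral form with measurable
`h₁, s : (0, ∞) → ℝ`, `h₁ ≥ 0`. Functions on `[1, ∞)` and on `(0, ∞)` are total functions on `ℝ` of
which only the values on these intervals are constrained. All integrals are convergent Lebesgue
integrals. -/
structure IsIntegralForm (g s h₁ : ℝ → ℝ) : Prop where
  measurable_h : Measurable (fun y : Set.Ioi (0 : ℝ) => h₁ y)
  measurable_s : Measurable (fun y : Set.Ioi (0 : ℝ) => s y)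
  nonneg : ∀ y : ℝ, 0 < y → 0 ≤ h₁ y
  integrable_weight :
    IntegrableOn (fun y : ℝ => h₁ y * Real.exp (-y) * (1 - Real.exp (-y))) (Set.Ioi 0)
  weight_pos :
    0 < ∫ y in Set.Ioi (0 : ℝ), h₁ y * Real.exp (-y) * (1 - Real.exp (-y))
  integrable_form : ∀ x : ℝ, 1 ≤ x →
    IntegrableOn (fun y : ℝ => h₁ y * (s y - Real.exp (-(x * y)))) (Set.Ioi 0)
  eq_integral : ∀ x : ℝ, 1 ≤ x →
    g x = ∫ y in Set.Ioi (0 : ℝ), h₁ y * (s y - Real.exp (-(x * y)))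

section RandomVariables

variable {Ω : Type} [MeasurableSpace Ω]

/-- The joint law of `k` independent copies of the random variable `X`. -/
noncomputable def iidLaw (P : Measure Ω) (X : Ω → ℝ) (k : ℕ) : Measure (Fin k → ℝ) :=
  Measure.pi (fun _ : Fin k => P.map X)

/-- The expected maximum of `k` independent copies of `X` (used for `k ≥ 1`). -/
noncomputable def expectedMax (P : Measure Ω) (X : Ω → ℝ) (k : ℕ) : ℝ :=
  ∫ x, (⨆ i, x i) ∂(iidLaw P X k)

/-- The expected range (maximum minus minimum) of `k` independent copies of `X`
(used for `k ≥ 1`). -/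
noncomputable def expectedRange (P : Measure Ω) (X : Ω → ℝ) (k : ℕ) : ℝ :=
  ∫ x, ((⨆ i, x i) - ⨅ i, x i) ∂(iidLaw P X k)

/-- `X` is an integrable real random variable on the probability space `(Ω, P)`, and it is
non-degenerate: not almost surely equal to a constant. -/
structure IsNondegenerateRV (P : Measure Ω) (X : Ω → ℝ) : Prop where
  isProbabilityMeasure : IsProbabilityMeasure P
  measurable : Measurable X
  integrable : Integrable X P
  nondegenerate : ¬ ∃ c : ℝ, ∀ᵐ ω ∂P, X ω = c

/-- `X` is symmetric about its mean: `X - E X` and `-(X - E X)` have the same law. -/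
def IsSymmetricAboutMean (P : Measure Ω) (X : Ω → ℝ) : Prop :=
  IdentDistrib (fun ω => X ω - ∫ ω', X ω' ∂P) (fun ω => -(X ω - ∫ ω', X ω' ∂P)) P P

end RandomVariables

/-- The sequence `(m k)_{k ≥ 1}` is an expected maxima sequence of a non-degenerate integrable
random variable that is symmetric about its mean. -/
def IsSymmetricEMS (m : ℕ → ℝ) : Prop :=
  ∃ (Ω : Type) (_ : MeasurableSpace Ω) (P : Measure Ω) (X : Ω → ℝ),
    IsNondegenerateRV P X ∧ IsSymmetricAboutMean P X ∧ ∀ k : ℕ, 1 ≤ k → expectedMax P X k = m k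

/-- The sequence `(r k)_{k ≥ 1}` is an expected ranges sequence of a non-degenerate integrable
random variable. -/
def IsNondegenerateERS (r : ℕ → ℝ) : Prop :=
  ∃ (Ω : Type) (_ : MeasurableSpace Ω) (P : Measure Ω) (X : Ω → ℝ),
    IsNondegenerateRV P X ∧ ∀ k : ℕ, 1 ≤ k → expectedRange P X k = r k

/-! Put `u = e^{-y}`. The involution `y ↦ -log (1 - e^{-y})` becomes `u ↦ 1 - u`, and its Jacobian
is `1 / (e^y - 1)`. So (*) says that the measure `h₁ y dy`, carried to `(0, 1)`, is symmetric about
`1/2`.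

Sufficiency: with `U` uniform on `(0, 1)`, let `X = q(U)`, where `q = quantileForm s h₁` is
increasing. The maximum of `k` copies is `q` of a variable with distribution function `a ^ k`, so
Fubini gives `E max = ∫ h₁ (s - e^{-ky}) = g k`, without using (*). Under (*), `q u + q (1 - u)` is
constant, hence `X` is symmetric.

Necessity, for ranges: if `F` is the distribution function of `X`, the expected range is `∫ (1 - F^k
- (1 - F)^k)`. Its increments are the moments of a finite measure on `[0, 1]` that is invariant
under `u ↦ 1 - u`. The increments of `g` are the moments of the image of `h₁ e^{-y} (1 - e^{-y}) dy`
under `e^{-y}`. Moments determine the measure, so that image is symmetric too, which is (*)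
(`map_weight_eq`).

Maxima and ranges are linked by `IsSymmetricEMS.isNondegenerateERS`: for symmetric `X` the expected
range is `2 (m k - m 1)`. Thus (i) needs only the necessity half for ranges, and (ii) only the
construction for maxima. -/

/-! ### The involution and its change of variables -/

/-- The involution of `(0, ∞)` that is conjugate to `u ↦ 1 - u` on `(0, 1)` under `y ↦ exp (-y)`. -/
noncomputable def expReflect (y : ℝ) : ℝ := -Real.log (1 - Real.exp (-y))

lemma exp_neg_lt_one {y : ℝ} (hy : 0 < y) : Real.exp (-y) < 1 := by
  rw [Real.exp_lt_one_iff]; linarith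

lemma exp_neg_expReflect {y : ℝ} (hy : 0 < y) : Real.exp (-expReflect y) = 1 - Real.exp (-y) := by
  rw [expReflect, neg_neg, Real.exp_log (by linarith [exp_neg_lt_one hy])]

lemma expReflect_pos {y : ℝ} (hy : 0 < y) : 0 < expReflect y := by
  have h := exp_neg_expReflect hy
  have h2 : Real.exp (-expReflect y) < 1 := by rw [h]; linarith [Real.exp_pos (-y)]
  rw [Real.exp_lt_one_iff] at h2
  linarith

lemma expReflect_expReflect {y : ℝ} (hy : 0 < y) : expReflect (expReflect y) = y := by
  rw [expReflect, exp_neg_expReflect hy]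
  simp

lemma measurable_expReflect : Measurable expReflect := by
  unfold expReflect; fun_prop

lemma image_expReflect : expReflect '' Set.Ioi 0 = Set.Ioi 0 := by
  ext y
  constructor
  · rintro ⟨x, hx, rfl⟩
    exact expReflect_pos hx
  · intro hy
    exact ⟨expReflect y, expReflect_pos hy, expReflect_expReflect hy⟩

lemma hasDerivAt_expReflect {y : ℝ} (hy : 0 < y) :
    HasDerivAt expReflect (-(Real.exp y - 1)⁻¹) y := by
  have h1 : HasDerivAt (fun y : ℝ => 1 - Real.exp (-y)) (Real.exp (-y)) y := by
    simpa using ((hasDerivAt_neg y).exp).const_sub 1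
  have hpos : 0 < 1 - Real.exp (-y) := by linarith [exp_neg_lt_one hy]
  have h2 := (h1.log hpos.ne').neg
  have h3 : 0 < Real.exp y - 1 := by linarith [Real.add_one_lt_exp hy.ne']
  have h4 : Real.exp (-y) * Real.exp y = 1 := by rw [← Real.exp_add]; simp
  have h5 : (Real.exp y - 1)⁻¹ = Real.exp (-y) / (1 - Real.exp (-y)) := by
    rw [inv_eq_one_div, div_eq_div_iff h3.ne' hpos.ne']
    linarith
  rw [h5]
  exact h2

/-- Change of variables for an involution; the Jacobian is the source of the factor `e^y - 1` in
(*). -/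
lemma map_expReflect_withDensity (f : ℝ → ENNReal) :
    ((volume.restrict (Set.Ioi (0 : ℝ))).withDensity f).map expReflect =
      (volume.restrict (Set.Ioi (0 : ℝ))).withDensity
        (fun y => ENNReal.ofReal (Real.exp y - 1)⁻¹ * f (expReflect y)) := by
  ext A hA
  have hinj : Set.InjOn expReflect (Set.Ioi 0) := fun x hx y hy h => by
    rw [← expReflect_expReflect hx, h, expReflect_expReflect hy]
  rw [Measure.map_apply measurable_expReflect hA,
    withDensity_apply _ (measurable_expReflect hA), withDensity_apply _ hA,
    ← lintegral_indicator (measurable_expReflect hA), ← lintegral_indicator hA]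
  have key := lintegral_image_eq_lintegral_abs_deriv_mul measurableSet_Ioi
    (fun x hx => (hasDerivAt_expReflect hx).hasDerivWithinAt) hinj
    ((expReflect ⁻¹' A).indicator f)
  rw [image_expReflect] at key
  rw [key]
  refine setLIntegral_congr_fun measurableSet_Ioi fun y hy => ?_
  have hy' : (0 : ℝ) < y := hy
  have h3 : 0 < Real.exp y - 1 := by linarith [Real.add_one_lt_exp hy'.ne']
  have h5 : |-(Real.exp y - 1)⁻¹| = (Real.exp y - 1)⁻¹ := by
    rw [abs_neg, abs_of_pos (inv_pos.2 h3)]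
  by_cases hA' : y ∈ A <;>
    simp [h5, Set.indicator, Set.mem_preimage, expReflect_expReflect hy', hA']

lemma measurable_indicator_Ioi {f : ℝ → ℝ} (hf : Measurable (fun y : Set.Ioi (0 : ℝ) => f y)) :
    Measurable ((Set.Ioi (0 : ℝ)).indicator f) := by
  refine measurable_of_restrict_of_restrict_compl (measurableSet_Ioi (a := (0 : ℝ))) ?_ ?_
  · have h : (Set.Ioi (0 : ℝ)).domRestrict ((Set.Ioi (0 : ℝ)).indicator f) =
        fun y : Set.Ioi (0 : ℝ) => f y := by
      ext y
      exact Set.indicator_of_mem y.2 f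
    rw [h]
    exact hf
  · have h : (Set.Ioi (0 : ℝ))ᶜ.domRestrict ((Set.Ioi (0 : ℝ)).indicator f) = fun _ => 0 := by
      ext y
      exact Set.indicator_of_notMem y.2 f
    rw [h]
    exact measurable_const

/-! ### Moments determine a finite measure on `[0, 1]` -/

/-- Equal moments give equal integrals of polynomials, hence of continuous functions by Weierstrass
approximation on `[0, 1]`. -/
lemma Measure.ext_of_forall_integral_pow_eq {μ ν : Measure ℝ} [IsFiniteMeasure μ]
    [IsFiniteMeasure ν] (hμ : ∀ᵐ x ∂μ, x ∈ Set.Icc (0 : ℝ) 1) (hν : ∀ᵐ x ∂ν, x ∈ Set.Icc (0 : ℝ) 1)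
    (h : ∀ n : ℕ, ∫ x, x ^ n ∂μ = ∫ x, x ^ n ∂ν) : μ = ν := by
  have hint : ∀ (ρ : Measure ℝ) [IsFiniteMeasure ρ], (∀ᵐ x ∂ρ, x ∈ Set.Icc (0 : ℝ) 1) →
      ∀ n : ℕ, Integrable (fun x => x ^ n) ρ := by
    intro ρ _ hρ n
    refine Integrable.of_bound (by fun_prop) 1 ?_
    filter_upwards [hρ] with x hx
    rw [Real.norm_eq_abs, abs_pow]
    exact pow_le_one₀ (abs_nonneg _) (by rw [abs_of_nonneg hx.1]; exact hx.2)
  have hpint : ∀ (ρ : Measure ℝ) [IsFiniteMeasure ρ], (∀ᵐ x ∂ρ, x ∈ Set.Icc (0 : ℝ) 1) →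
      ∀ p : Polynomial ℝ, Integrable (fun x => p.eval x) ρ := by
    intro ρ _ hρ p
    simp_rw [Polynomial.eval_eq_sum_range]
    exact integrable_finsetSum _ fun i _ => (hint ρ hρ i).const_mul _
  have hp : ∀ p : Polynomial ℝ, ∫ x, p.eval x ∂μ = ∫ x, p.eval x ∂ν := by
    intro p
    simp_rw [Polynomial.eval_eq_sum_range]
    rw [integral_finsetSum _ fun i _ => (hint μ hμ i).const_mul _,
      integral_finsetSum _ fun i _ => (hint ν hν i).const_mul _]
    simp_rw [integral_const_mul, h]
  refine ext_of_forall_integral_eq_of_IsFiniteMeasure fun f => ?_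
  have close : ∀ (ρ : Measure ℝ) [IsFiniteMeasure ρ], (∀ᵐ x ∂ρ, x ∈ Set.Icc (0 : ℝ) 1) →
      ∀ (p : Polynomial ℝ) (ε : ℝ), (∀ x ∈ Set.Icc (0 : ℝ) 1, |p.eval x - f x| < ε) →
      |∫ x, p.eval x ∂ρ - ∫ x, f x ∂ρ| ≤ ε * ρ.real Set.univ := by
    intro ρ _ hρ p ε hpε
    rw [← integral_sub (hpint ρ hρ p) (f.integrable ρ)]
    refine norm_integral_le_of_norm_le_const (f := fun x => p.eval x - f x) ?_
    filter_upwards [hρ] with x hx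
    exact (hpε x hx).le
  have hle : ∀ ε : ℝ, 0 < ε →
      |∫ x, f x ∂μ - ∫ x, f x ∂ν| ≤ ε * (μ.real Set.univ + ν.real Set.univ) := by
    intro ε hε
    obtain ⟨p, hpε⟩ := exists_polynomial_near_of_continuousOn 0 1 f f.continuous.continuousOn ε hε
    have h1 := close μ hμ p ε hpε
    have h2 := close ν hν p ε hpε
    rw [hp p] at h1
    rw [abs_le] at *
    constructor <;> linarith [h1.1, h1.2, h2.1, h2.2]
  by_contra hne
  set C := μ.real Set.univ + ν.real Set.univ
  have hC : 0 ≤ C := by positivity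
  have hpos : 0 < |∫ x, f x ∂μ - ∫ x, f x ∂ν| := abs_pos.2 (sub_ne_zero.2 hne)
  have h3 := hle (|∫ x, f x ∂μ - ∫ x, f x ∂ν| / (C + 1)) (by positivity)
  rw [div_mul_eq_mul_div, le_div_iff₀ (by positivity)] at h3
  nlinarith


/-! ### Maxima and ranges of independent copies -/

lemma abs_ciSup_le_sum {k : ℕ} [NeZero k] (x : Fin k → ℝ) : |⨆ i, x i| ≤ ∑ i, |x i| := by
  obtain ⟨i, hi⟩ := exists_eq_ciSup_of_finite (f := x)
  rw [← hi]
  exact Finset.single_le_sum (f := fun i => |x i|) (fun _ _ => abs_nonneg _) (Finset.mem_univ i)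

lemma neg_ciSup_neg {k : ℕ} (x : Fin k → ℝ) : -(⨆ i, -x i) = ⨅ i, x i := by
  rw [iInf, iSup, ← Real.sInf_neg]
  congr 1
  ext y
  simp [neg_eq_iff_eq_neg]


lemma integrable_ciSup_pi (μ : Measure ℝ) [IsProbabilityMeasure μ]
    (hμ : Integrable (fun x => x) μ) (k : ℕ) [NeZero k] :
    Integrable (fun x : Fin k → ℝ => ⨆ i, x i) (Measure.pi fun _ => μ) := by
  have h : ∀ i : Fin k, Integrable (fun x : Fin k → ℝ => |x i|) (Measure.pi fun _ => μ) :=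
    fun i => (integrable_comp_eval (μ := fun _ : Fin k => μ) (i := i) hμ).abs
  refine (integrable_finsetSum Finset.univ fun i _ => h i).mono'
    (Measurable.iSup fun i => measurable_pi_apply i).aestronglyMeasurable ?_
  filter_upwards with x
  exact abs_ciSup_le_sum x

lemma integrable_ciInf_pi (μ : Measure ℝ) [IsProbabilityMeasure μ]
    (hμ : Integrable (fun x => x) μ) (k : ℕ) [NeZero k] :
    Integrable (fun x : Fin k → ℝ => ⨅ i, x i) (Measure.pi fun _ => μ) := by
  have h : ∀ i : Fin k, Integrable (fun x : Fin k → ℝ => |x i|) (Measure.pi fun _ => μ) :=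
    fun i => (integrable_comp_eval (μ := fun _ : Fin k => μ) (i := i) hμ).abs
  refine (integrable_finsetSum Finset.univ fun i _ => h i).mono'
    (Measurable.iInf fun i => measurable_pi_apply i).aestronglyMeasurable ?_
  filter_upwards with x
  rw [← neg_ciSup_neg, norm_neg]
  simpa using abs_ciSup_le_sum (fun i => -x i)

/-- With `F t = μ (-∞, t]`, the expected range is `∫ (1 - F ^ k - (1 - F) ^ k)`. -/
lemma integral_range_pi (μ : Measure ℝ) [IsProbabilityMeasure μ]
    (hμ : Integrable (fun x => x) μ) (k : ℕ) [NeZero k] :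
    Integrable (fun t => 1 - μ.real (Set.Iic t) ^ k - (1 - μ.real (Set.Iic t)) ^ k) ∧
    ∫ x, ((⨆ i, x i) - ⨅ i, x i) ∂(Measure.pi fun _ : Fin k => μ) =
      ∫ t, (1 - μ.real (Set.Iic t) ^ k - (1 - μ.real (Set.Iic t)) ^ k) := by
  set P := Measure.pi fun _ : Fin k => μ
  have hbdA : ∀ x : Fin k → ℝ, BddAbove (Set.range x) := fun x => (Set.finite_range x).bddAbove
  have hbdB : ∀ x : Fin k → ℝ, BddBelow (Set.range x) := fun x => (Set.finite_range x).bddBelow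
  have hle : ∀ x : Fin k → ℝ, ⨅ i, x i ≤ ⨆ i, x i := fun x =>
    (ciInf_le (hbdB x) 0).trans (le_ciSup (hbdA x) 0)
  have hmS : Measurable fun x : Fin k → ℝ => ⨆ i, x i :=
    Measurable.iSup fun i => measurable_pi_apply i
  have hmI : Measurable fun x : Fin k → ℝ => ⨅ i, x i :=
    Measurable.iInf fun i => measurable_pi_apply i
  have hint : Integrable (fun x : Fin k → ℝ => (⨆ i, x i) - ⨅ i, x i) P :=
    (integrable_ciSup_pi μ hμ k).sub (integrable_ciInf_pi μ hμ k)
  -- Tonelli on the region between minimum and maximum: slices at fixed `x` have length the range;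
  -- the slice at fixed `t` is the event that the sample is neither entirely `≤ t` nor entirely `>
  -- t`.
  let S : Set ((Fin k → ℝ) × ℝ) := {p | ⨅ i, p.1 i ≤ p.2 ∧ p.2 < ⨆ i, p.1 i}
  have hS : MeasurableSet S :=
    (measurableSet_le (hmI.comp measurable_fst) measurable_snd).inter
      (measurableSet_lt measurable_snd (hmS.comp measurable_fst))
  have h1 : ∀ x : Fin k → ℝ, volume (Prod.mk x ⁻¹' S) =
      ENNReal.ofReal ((⨆ i, x i) - ⨅ i, x i) := fun x => by
    rw [← Real.volume_Ico]; rfl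
  have h2 : ∀ t : ℝ, P ((fun x => (x, t)) ⁻¹' S) =
      ENNReal.ofReal (1 - μ.real (Set.Iic t) ^ k - (1 - μ.real (Set.Iic t)) ^ k) := fun t => by
    have e : ((fun x => (x, t)) ⁻¹' S) =
        ((Set.univ.pi fun _ : Fin k => Set.Iic t) ∪ (Set.univ.pi fun _ : Fin k => Set.Ioi t))ᶜ := by
      ext x
      have e1 : t < ⨆ i, x i ↔ ∃ i, t < x i := lt_ciSup_iff (hbdA x)
      have e2 : ⨅ i, x i ≤ t ↔ ∃ i, x i ≤ t := by
        constructor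
        · intro h
          obtain ⟨i, hi⟩ := exists_eq_ciInf_of_finite (f := x)
          exact ⟨i, hi ▸ h⟩
        · rintro ⟨i, hi⟩
          exact (ciInf_le (hbdB x) i).trans hi
      simp only [S, Set.mem_preimage, Set.mem_ofPred_eq, e1, e2, Set.mem_compl_iff, Set.mem_union,
        Set.mem_univ_pi, Set.mem_Iic, Set.mem_Ioi, not_or, not_forall, not_le, not_lt]
      tauto
    have m1 : MeasurableSet (Set.univ.pi fun _ : Fin k => Set.Iic t) :=
      MeasurableSet.univ_pi fun _ => measurableSet_Iic
    have m2 : MeasurableSet (Set.univ.pi fun _ : Fin k => Set.Ioi t) :=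
      MeasurableSet.univ_pi fun _ => measurableSet_Ioi
    have hd : Disjoint (Set.univ.pi fun _ : Fin k => Set.Iic t)
        (Set.univ.pi fun _ : Fin k => Set.Ioi t) := by
      rw [Set.disjoint_left]
      intro x hx hx'
      exact not_lt.2 (Set.mem_Iic.1 (hx 0 trivial)) (Set.mem_Ioi.1 (hx' 0 trivial))
    rw [e, ← ofReal_measureReal, probReal_compl_eq_one_sub (m1.union m2),
      measureReal_union hd m2]
    have hI : μ.real (Set.Ioi t) = 1 - μ.real (Set.Iic t) := by
      rw [← probReal_compl_eq_one_sub measurableSet_Iic, Set.compl_Iic]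
    simp only [P, Measure.real, Measure.pi_pi, Finset.prod_const, Finset.card_univ,
      Fintype.card_fin, ENNReal.toReal_pow] at hI ⊢
    rw [hI]
    ring_nf
  have h0 : ∀ t : ℝ, 0 ≤ 1 - μ.real (Set.Iic t) ^ k - (1 - μ.real (Set.Iic t)) ^ k := fun t => by
    have a0 : 0 ≤ μ.real (Set.Iic t) := measureReal_nonneg
    have a1 : μ.real (Set.Iic t) ≤ 1 := measureReal_le_one
    have := pow_le_of_le_one a0 a1 (NeZero.ne k)
    have := pow_le_of_le_one (sub_nonneg.2 a1) (by linarith) (NeZero.ne k)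
    linarith
  have hswap : ∫⁻ x, ENNReal.ofReal ((⨆ i, x i) - ⨅ i, x i) ∂P =
      ∫⁻ t, ENNReal.ofReal (1 - μ.real (Set.Iic t) ^ k - (1 - μ.real (Set.Iic t)) ^ k) := by
    simp_rw [← h1, ← h2]
    rw [← Measure.prod_apply hS, ← Measure.prod_apply_symm hS]
  have hF : Measurable fun t => μ.real (Set.Iic t) :=
    (show Monotone fun t => μ.real (Set.Iic t) from
      fun a b hab => measureReal_mono (Set.Iic_subset_Iic.2 hab)).measurable
  have hm : Measurable fun t => 1 - μ.real (Set.Iic t) ^ k - (1 - μ.real (Set.Iic t)) ^ k := by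
    fun_prop
  constructor
  · refine ⟨hm.aestronglyMeasurable, ?_⟩
    rw [hasFiniteIntegral_iff_ofReal (Filter.Eventually.of_forall h0), ← hswap,
      ← hasFiniteIntegral_iff_ofReal (Filter.Eventually.of_forall fun x => sub_nonneg.2 (hle x))]
    exact hint.2
  · rw [integral_eq_lintegral_of_nonneg_ae
      (Filter.Eventually.of_forall fun x => sub_nonneg.2 (hle x)) hint.1, hswap,
      integral_eq_lintegral_of_nonneg_ae (Filter.Eventually.of_forall h0) hm.aestronglyMeasurable]


/-! ### Reflection: from symmetric maxima to ranges -/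

lemma ciInf_const_sub {k : ℕ} [NeZero k] (a : ℝ) (x : Fin k → ℝ) :
    ⨅ i, (a - x i) = a - ⨆ i, x i := by
  apply le_antisymm
  · obtain ⟨i, hi⟩ := exists_eq_ciSup_of_finite (f := x)
    rw [← hi]
    exact ciInf_le (Set.finite_range _).bddBelow i
  · exact le_ciInf fun i => sub_le_sub_left (le_ciSup (Set.finite_range x).bddAbove i) a

lemma integral_ciInf_pi_of_map_sub_eq (μ : Measure ℝ) [IsProbabilityMeasure μ]
    (hμ : Integrable (fun x => x) μ) (a : ℝ) (ha : μ.map (fun x => a - x) = μ) (k : ℕ) [NeZero k] :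
    ∫ x, (⨅ i, x i) ∂(Measure.pi fun _ : Fin k => μ) =
      a - ∫ x, (⨆ i, x i) ∂(Measure.pi fun _ : Fin k => μ) := by
  have hmp : MeasurePreserving (fun (x : Fin k → ℝ) i => a - x i)
      (Measure.pi fun _ => μ) (Measure.pi fun _ => μ) :=
    measurePreserving_pi (fun _ : Fin k => μ) (fun _ => μ) fun _ => ⟨by fun_prop, ha⟩
  have hmI : Measurable fun x : Fin k → ℝ => ⨅ i, x i :=
    Measurable.iInf fun i => measurable_pi_apply i
  conv_lhs => rw [← hmp.map_eq]
  rw [integral_map hmp.measurable.aemeasurable hmI.aestronglyMeasurable]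
  simp_rw [ciInf_const_sub]
  rw [integral_sub (integrable_const _) (integrable_ciSup_pi μ hμ k)]
  simp

lemma integral_ciSup_pi_one (μ : Measure ℝ) [IsProbabilityMeasure μ] :
    ∫ x, (⨆ i, x i) ∂(Measure.pi fun _ : Fin 1 => μ) = ∫ x, x ∂μ := by
  have h := (measurePreserving_eval (fun _ : Fin 1 => μ) 0)
  conv_rhs => rw [← h.map_eq]
  rw [integral_map h.measurable.aemeasurable (by fun_prop)]
  simp [ciSup_unique, Function.eval]

/-- Reflection in the mean `c = m 1` exchanges maximum and minimum, so `E min = 2c - E max`. -/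
lemma IsSymmetricEMS.isNondegenerateERS {m : ℕ → ℝ} (hm : IsSymmetricEMS m) :
    IsNondegenerateERS (fun k => 2 * (m k - m 1)) := by
  obtain ⟨Ω, mΩ, P, X, hX, hsym, hmax⟩ := hm
  refine ⟨Ω, mΩ, P, X, hX, fun k hk => ?_⟩
  have := hX.isProbabilityMeasure
  have : IsProbabilityMeasure (P.map X) :=
    Measure.isProbabilityMeasure_map hX.measurable.aemeasurable
  have : NeZero k := ⟨by omega⟩
  have hint : Integrable (fun x => x) (P.map X) :=
    (integrable_map_measure (by fun_prop) hX.measurable.aemeasurable).2 hX.integrable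
  set c := ∫ ω, X ω ∂P with hc
  have hrefl : (P.map X).map (fun x => 2 * c - x) = P.map X := by
    have h := hsym.map_eq
    rw [← hc] at h
    have hXm := hX.measurable
    have h1 := congrArg (Measure.map fun x => x + c) h
    rw [Measure.map_map (by fun_prop) (by fun_prop),
      Measure.map_map (by fun_prop) (by fun_prop)] at h1
    rw [Measure.map_map (by fun_prop) (by fun_prop)]
    convert h1.symm using 2
    · ext ω; simp; ring
    · ext ω; simp
  have hmean : c = m 1 := by
    rw [← hmax 1 le_rfl, expectedMax, iidLaw, integral_ciSup_pi_one,
      integral_map hX.measurable.aemeasurable (by fun_prop)]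
  rw [expectedRange, iidLaw, integral_sub (integrable_ciSup_pi _ hint k)
    (integrable_ciInf_pi _ hint k), integral_ciInf_pi_of_map_sub_eq _ hint _ hrefl k]
  beta_reduce
  rw [← hmax k hk, ← hmean, expectedMax, iidLaw]
  ring

lemma IsNondegenerateERS.apply_one {r : ℕ → ℝ} (hr : IsNondegenerateERS r) : r 1 = 0 := by
  obtain ⟨Ω, mΩ, P, X, hX, hr⟩ := hr
  rw [← hr 1 le_rfl, expectedRange]
  simp [ciSup_unique, ciInf_unique]

/-! ### Necessity of (*): comparison of moments -/

namespace IsIntegralForm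

variable {g s h : ℝ → ℝ}

/-- The function `s` cancels in increments, leaving the `n`-th moment of `e^{-y}` under the finite
weight. -/
lemma sub_eq_integral (hg : IsIntegralForm g s h) (n : ℕ) :
    g ((n + 2 : ℕ) : ℝ) - g ((n + 1 : ℕ) : ℝ) = ∫ y in Set.Ioi (0 : ℝ),
      h y * Real.exp (-y) * (1 - Real.exp (-y)) * Real.exp (-y) ^ n := by
  have e1 : (1 : ℝ) ≤ ((n + 1 : ℕ) : ℝ) := by norm_num
  have e2 : (1 : ℝ) ≤ ((n + 2 : ℕ) : ℝ) := by push_cast; linarith [(Nat.cast_nonneg n : (0 : ℝ) ≤ n)]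
  rw [hg.eq_integral _ e1, hg.eq_integral _ e2,
    ← integral_sub (hg.integrable_form _ e2) (hg.integrable_form _ e1)]
  refine integral_congr_ae (Filter.Eventually.of_forall fun y => ?_)
  have p : ∀ k : ℕ, Real.exp (-((k : ℝ) * y)) = Real.exp (-y) ^ k := fun k => by
    rw [← Real.exp_nat_mul]; congr 1; ring
  simp only [p]
  ring

/-- The law of `exp (-y)` under the weight `h y e^{-y} (1 - e^{-y}) dy` is invariant under
`u ↦ 1 - u`, because its moments are those of the symmetric measure attached to the range. -/
lemma map_weight_eq (hg : IsIntegralForm g s h) (hr : IsNondegenerateERS (fun k : ℕ => g k))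
    (w : ℝ → ℝ) (hw : Measurable w)
    (hwh : ∀ y, 0 < y → w y = h y * Real.exp (-y) * (1 - Real.exp (-y))) :
    ((volume.restrict (Set.Ioi (0 : ℝ))).withDensity fun y => ENNReal.ofReal (w y)).map expReflect =
      (volume.restrict (Set.Ioi (0 : ℝ))).withDensity fun y => ENNReal.ofReal (w y) := by
  obtain ⟨Ω, mΩ, P, X, hX, hr⟩ := hr
  have := hX.isProbabilityMeasure
  have : IsProbabilityMeasure (P.map X) :=
    Measure.isProbabilityMeasure_map hX.measurable.aemeasurable
  have hint : Integrable (fun x => x) (P.map X) :=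
    (integrable_map_measure (by fun_prop) hX.measurable.aemeasurable).2 hX.integrable
  set ν := volume.restrict (Set.Ioi (0 : ℝ)) with hν
  have hpos : ∀ᵐ y ∂ν, 0 < y := ae_restrict_mem measurableSet_Ioi
  have hw0 : ∀ y, 0 < y → 0 ≤ w y := fun y hy => by
    rw [hwh y hy]
    exact mul_nonneg (mul_nonneg (hg.nonneg y hy) (Real.exp_pos _).le)
      (by linarith [exp_neg_lt_one hy])
  have hwint : Integrable w ν :=
    hg.integrable_weight.congr (hpos.mono fun y hy => (hwh y hy).symm)
  set W := ν.withDensity fun y => ENNReal.ofReal (w y)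
  have : IsFiniteMeasure W := isFiniteMeasure_withDensity_ofReal hwint.2
  set F : ℝ → ℝ := fun t => (P.map X).real (Set.Iic t) with hFdef
  have hF : Measurable F :=
    (show Monotone F from fun a b hab => measureReal_mono (Set.Iic_subset_Iic.2 hab)).measurable
  have hF0 : ∀ t, 0 ≤ F t := fun t => measureReal_nonneg
  have hF1 : ∀ t, F t ≤ 1 := fun t => measureReal_le_one
  have hrange : ∀ n : ℕ, Integrable (fun t => 1 - F t ^ (n + 1) - (1 - F t) ^ (n + 1)) ∧
      g ((n + 1 : ℕ) : ℝ) = ∫ t, (1 - F t ^ (n + 1) - (1 - F t) ^ (n + 1)) := fun n => by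
    obtain ⟨i1, i2⟩ := integral_range_pi (P.map X) hint (n + 1)
    refine ⟨i1, ?_⟩
    have e := hr (n + 1) (by omega)
    beta_reduce at e
    rw [← e, expectedRange, iidLaw, i2]
  have hb0 : ∀ t, 0 ≤ F t * (1 - F t) := fun t => mul_nonneg (hF0 t) (sub_nonneg.2 (hF1 t))
  -- The range integrand for two copies is `2 F (1 - F)`.
  have hbint : Integrable fun t => F t * (1 - F t) := by
    refine ((hrange 1).1.div_const 2).congr (Filter.Eventually.of_forall fun t => ?_)
    ring
  set V := (volume : Measure ℝ).withDensity fun t => ENNReal.ofReal (F t * (1 - F t))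
  have : IsFiniteMeasure V := isFiniteMeasure_withDensity_ofReal hbint.2
  have hE : Measurable fun y : ℝ => Real.exp (-y) := by fun_prop
  have hF' : Measurable fun t => 1 - F t := by fun_prop
  -- Both sides have `g (n + 2) - g (n + 1)` as `n`-th moment, since consecutive range integrands
  -- differ by `F (1 - F) (F^n + (1 - F)^n)`.
  have hmom : W.map (fun y => Real.exp (-y)) = V.map F + V.map fun t => 1 - F t := by
    apply Measure.ext_of_forall_integral_pow_eq
    · rw [ae_map_iff (p := fun x => x ∈ Set.Icc (0 : ℝ) 1) hE.aemeasurable measurableSet_Icc]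
      filter_upwards [(withDensity_absolutelyContinuous ν _).ae_le hpos] with y hy
      exact ⟨(Real.exp_pos _).le, (exp_neg_lt_one hy).le⟩
    · rw [ae_add_measure_iff, ae_map_iff (p := fun x => x ∈ Set.Icc (0 : ℝ) 1) hF.aemeasurable measurableSet_Icc,
        ae_map_iff (p := fun x => x ∈ Set.Icc (0 : ℝ) 1) hF'.aemeasurable measurableSet_Icc]
      exact ⟨Filter.Eventually.of_forall fun t => ⟨hF0 t, hF1 t⟩, Filter.Eventually.of_forall
        fun t => ⟨sub_nonneg.2 (hF1 t), by linarith [hF0 t]⟩⟩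
    · intro n
      have j1 : Integrable (fun t => F t ^ n) V := by
        refine Integrable.of_bound (by fun_prop) 1 (Filter.Eventually.of_forall fun t => ?_)
        rw [Real.norm_of_nonneg (pow_nonneg (hF0 t) n)]
        exact pow_le_one₀ (hF0 t) (hF1 t)
      have j2 : Integrable (fun t => (1 - F t) ^ n) V := by
        refine Integrable.of_bound (by fun_prop) 1 (Filter.Eventually.of_forall fun t => ?_)
        rw [Real.norm_of_nonneg (pow_nonneg (sub_nonneg.2 (hF1 t)) n)]
        exact pow_le_one₀ (sub_nonneg.2 (hF1 t)) (by linarith [hF0 t])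
      rw [integral_add_measure, integral_map hE.aemeasurable (by fun_prop),
        integral_map hF.aemeasurable (by fun_prop), integral_map hF'.aemeasurable (by fun_prop),
        ← integral_add j1 j2,
        integral_withDensity_eq_integral_toReal_smul (by fun_prop) (by simp),
        integral_withDensity_eq_integral_toReal_smul (by fun_prop) (by simp)]
      · have l : ∫ y, (ENNReal.ofReal (w y)).toReal • Real.exp (-y) ^ n ∂ν =
            g ((n + 2 : ℕ) : ℝ) - g ((n + 1 : ℕ) : ℝ) := by
          rw [hg.sub_eq_integral n]
          refine setIntegral_congr_fun measurableSet_Ioi fun y hy => ?_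
          simp only [smul_eq_mul]
          rw [ENNReal.toReal_ofReal (hw0 y hy), hwh y hy]
        rw [l, (hrange n).2, (hrange (n + 1)).2, ← integral_sub (hrange (n + 1)).1 (hrange n).1]
        refine integral_congr_ae (Filter.Eventually.of_forall fun t => ?_)
        simp only [smul_eq_mul, ENNReal.toReal_ofReal (hb0 t)]
        ring
      · exact (integrable_map_measure (by fun_prop) hF.aemeasurable).2 j1
      · exact (integrable_map_measure (by fun_prop) hF'.aemeasurable).2 j2
  have hsub : Measurable fun u : ℝ => 1 - u := by fun_prop
  -- The map `u ↦ 1 - u` swaps the two summands of `hmom`.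
  have hsymm : (W.map fun y => Real.exp (-y)).map (fun u => 1 - u) =
      W.map fun y => Real.exp (-y) := by
    rw [hmom, Measure.map_add _ _ hsub, Measure.map_map hsub hF, Measure.map_map hsub hF',
      add_comm]
    congr 2
    ext t
    simp
  have hlog : Measurable fun u : ℝ => -Real.log u := by fun_prop
  calc W.map expReflect
      = ((W.map fun y => Real.exp (-y)).map fun u => 1 - u).map fun u => -Real.log u := by
        rw [Measure.map_map hsub hE, Measure.map_map hlog (hsub.comp hE)]
        rfl
    _ = W := by
        rw [hsymm, Measure.map_map hlog hE]
        convert Measure.map_id using 2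
        ext y
        simp

lemma ae_eq_of_isNondegenerateERS (hg : IsIntegralForm g s h)
    (hr : IsNondegenerateERS (fun k : ℕ => g k)) :
    ∀ᵐ y ∂(volume.restrict (Set.Ioi (0 : ℝ))),
      h (-Real.log (1 - Real.exp (-y))) = (Real.exp y - 1) * h y := by
  -- Only the restriction of `h` to `(0, ∞)` is measurable; the indicator makes the density
  -- measurable on `ℝ`.
  set w : ℝ → ℝ := fun y =>
    (Set.Ioi (0 : ℝ)).indicator h y * Real.exp (-y) * (1 - Real.exp (-y)) with hwdef
  have hw : Measurable w := by
    have := measurable_indicator_Ioi hg.measurable_h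
    fun_prop
  have hwh : ∀ y, 0 < y → w y = h y * Real.exp (-y) * (1 - Real.exp (-y)) := fun y hy => by
    rw [hwdef]
    simp only [Set.indicator_of_mem (Set.mem_Ioi.2 hy)]
  have hmap := hg.map_weight_eq hr w hw hwh
  rw [map_expReflect_withDensity, withDensity_eq_iff_of_sigmaFinite
    (by have := measurable_expReflect; fun_prop) (by fun_prop)] at hmap
  filter_upwards [hmap, ae_restrict_mem measurableSet_Ioi] with y hy hy0
  have hy0 : 0 < y := hy0
  change h (expReflect y) = _
  have hT := expReflect_pos hy0
  have h3 : 0 < Real.exp y - 1 := by linarith [Real.add_one_lt_exp hy0.ne']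
  have h1 := exp_neg_lt_one hy0
  have h4 : Real.exp (-y) * Real.exp y = 1 := by rw [← Real.exp_add]; simp
  have hp := Real.exp_pos (-y)
  have hw0 : ∀ y, 0 < y → 0 ≤ w y := fun y hy => by
    rw [hwh y hy]
    exact mul_nonneg (mul_nonneg (hg.nonneg y hy) (Real.exp_pos _).le)
      (by linarith [exp_neg_lt_one hy])
  rw [← ENNReal.ofReal_mul (inv_pos.2 h3).le, ENNReal.ofReal_eq_ofReal_iff
    (mul_nonneg (inv_pos.2 h3).le (hw0 _ hT)) (hw0 _ hy0), hwh _ hT, hwh _ hy0,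
    exp_neg_expReflect hy0, inv_mul_eq_iff_eq_mul₀ h3.ne'] at hy
  -- The factor `e^{-y} (1 - e^{-y})` is invariant under the involution, so it cancels and leaves
  -- (*).
  have h5 : Real.exp (-y) * (1 - Real.exp (-y)) ≠ 0 := (mul_pos hp (by linarith)).ne'
  apply mul_right_cancel₀ h5
  linarith

end IsIntegralForm

/-! ### Construction of a variable with expected maxima `g k` -/

/-- The increasing function on `(0, 1)` whose law under the uniform distribution has expected
maxima `∫ h y (s y - e^{-k y}) dy`. -/
noncomputable def quantileForm (s h : ℝ → ℝ) (u : ℝ) : ℝ :=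
  ∫ y in Set.Ioi (0 : ℝ), h y * (s y - if u ≤ Real.exp (-y) then 1 else 0)

namespace IsIntegralForm

variable {g s h : ℝ → ℝ}

lemma measurable_quantile_integrand (hh : Measurable h) (hs : Measurable s) :
    Measurable fun p : ℝ × ℝ => h p.2 * (s p.2 - if p.1 ≤ Real.exp (-p.2) then 1 else 0) := by
  have : Measurable fun p : ℝ × ℝ => if p.1 ≤ Real.exp (-p.2) then (1 : ℝ) else 0 :=
    Measurable.ite (measurableSet_le measurable_fst (by fun_prop)) measurable_const measurable_const
  fun_prop

lemma measurable_quantileForm (hh : Measurable h) (hs : Measurable s) :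
    Measurable (quantileForm s h) :=
  (StronglyMeasurable.integral_prod_right
    (f := fun u y => h y * (s y - if u ≤ Real.exp (-y) then 1 else 0))
    (measurable_quantile_integrand hh hs).stronglyMeasurable).measurable

/-- With `a = e^{-y}`, the integrand differs from that of `g 1` by `h y` times `a - 1_{u ≤ a}`,
which is at most a multiple of `a (1 - a)` for fixed `u`; the weight is integrable. -/
lemma integrable_quantile_integrand (hg : IsIntegralForm g s h) (hh : Measurable h)
    (hs : Measurable s) {u : ℝ} (hu : u ∈ Set.Ioo (0 : ℝ) 1) :
    IntegrableOn (fun y => h y * (s y - if u ≤ Real.exp (-y) then 1 else 0)) (Set.Ioi 0) := by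
  have h1 := (hg.integrable_form 1 le_rfl).norm.add
    (hg.integrable_weight.mul_const (u⁻¹ + (1 - u)⁻¹))
  refine h1.mono' ((measurable_quantile_integrand hh hs).comp
    (measurable_const (a := u).prodMk measurable_id)).aestronglyMeasurable ?_
  filter_upwards [ae_restrict_mem measurableSet_Ioi] with y hy
  have hy : 0 < y := hy
  have a0 := Real.exp_pos (-y)
  have a1 := exp_neg_lt_one hy
  have hy0 := hg.nonneg y hy
  simp only [Pi.add_apply, one_mul]
  set a := Real.exp (-y)
  have hu0 := hu.1
  have hu1 : 0 < 1 - u := by linarith [hu.2]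
  have key : |a - if u ≤ a then (1 : ℝ) else 0| ≤ a * (1 - a) * (u⁻¹ + (1 - u)⁻¹) := by
    have i1 : 0 < u⁻¹ := inv_pos.2 hu0
    have i2 : 0 < (1 - u)⁻¹ := inv_pos.2 hu1
    split_ifs with hua
    · rw [abs_of_neg (by linarith)]
      have : 1 ≤ a * u⁻¹ := by
        rw [← div_eq_mul_inv, le_div_iff₀ hu0]; linarith
      have h3 := mul_le_mul_of_nonneg_right this (by linarith : 0 ≤ 1 - a)
      have h4 : 0 ≤ a * (1 - a) * (1 - u)⁻¹ := by
        have : 0 ≤ 1 - a := by linarith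
        positivity
      nlinarith
    · rw [sub_zero, abs_of_pos a0]
      have : 1 ≤ (1 - a) * (1 - u)⁻¹ := by
        rw [← div_eq_mul_inv, le_div_iff₀ hu1]; linarith
      have h3 := mul_le_mul_of_nonneg_right this a0.le
      have h4 : 0 ≤ a * (1 - a) * u⁻¹ := by
        have : 0 ≤ 1 - a := by linarith
        positivity
      nlinarith
  calc ‖h y * (s y - if u ≤ a then (1 : ℝ) else 0)‖
      = ‖h y * (s y - a) + h y * (a - if u ≤ a then (1 : ℝ) else 0)‖ := by ring_nf
    _ ≤ ‖h y * (s y - a)‖ + ‖h y * (a - if u ≤ a then (1 : ℝ) else 0)‖ := norm_add_le _ _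
    _ ≤ _ := by
      gcongr
      rw [norm_mul, Real.norm_of_nonneg hy0, Real.norm_eq_abs, mul_assoc (h y), mul_assoc (h y)]
      exact mul_le_mul_of_nonneg_left key hy0

lemma monotoneOn_quantileForm (hg : IsIntegralForm g s h) (hh : Measurable h)
    (hs : Measurable s) : MonotoneOn (quantileForm s h) (Set.Ioo 0 1) := by
  intro u hu v hv huv
  refine setIntegral_mono_on (hg.integrable_quantile_integrand hh hs hu)
    (hg.integrable_quantile_integrand hh hs hv) measurableSet_Ioi fun y hy => ?_
  refine mul_le_mul_of_nonneg_left (sub_le_sub_left ?_ _) (hg.nonneg y hy)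
  split_ifs with h1 h2
  · rfl
  · exact absurd (huv.trans h1) h2
  · exact zero_le_one
  · rfl

/-- If `M` is distributed as the maximum of `k` independent uniform variables, then
`quantileForm s h ∘ M` is integrable with mean `g k`. -/
lemma integral_quantileForm_comp (hg : IsIntegralForm g s h) (hh : Measurable h)
    {Ω : Type*} [MeasurableSpace Ω] (Q : Measure Ω) [IsProbabilityMeasure Q]
    (M : Ω → ℝ) (hM : Measurable M) (k : ℕ) (hk : 1 ≤ k)
    (hlaw : ∀ a ∈ Set.Ioo (0 : ℝ) 1, Q.real {ω | M ω ≤ a} = a ^ k) :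
    Integrable (fun ω => quantileForm s h (M ω)) Q ∧ ∫ ω, quantileForm s h (M ω) ∂Q = g k := by
  set ν := volume.restrict (Set.Ioi (0 : ℝ)) with hν
  have hk' : (1 : ℝ) ≤ k := by exact_mod_cast hk
  have p : ∀ y : ℝ, Real.exp (-((k : ℝ) * y)) = Real.exp (-y) ^ k := fun y => by
    rw [← Real.exp_nat_mul]; congr 1; ring
  have hite : Measurable fun q : Ω × ℝ => if M q.1 ≤ Real.exp (-q.2) then (1 : ℝ) else 0 :=
    Measurable.ite (measurableSet_le (by fun_prop) (by fun_prop)) measurable_const measurable_const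
  have hIint : ∀ y, Integrable (fun ω => if M ω ≤ Real.exp (-y) then (1 : ℝ) else 0) Q := fun y => by
    refine Integrable.of_bound
      (hite.comp (measurable_id.prodMk measurable_const)).aestronglyMeasurable 1
      (Filter.Eventually.of_forall fun ω => ?_)
    split_ifs <;> simp
  have hI : ∀ y, 0 < y →
      ∫ ω, (if M ω ≤ Real.exp (-y) then (1 : ℝ) else 0) ∂Q = Real.exp (-y) ^ k := fun y hy => by
    rw [← hlaw _ ⟨Real.exp_pos _, exp_neg_lt_one hy⟩, ← integral_indicator_one
      (measurableSet_le hM measurable_const)]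
    rfl
  have i1 : Integrable (fun q : Ω × ℝ => h q.2 * (s q.2 - Real.exp (-q.2) ^ k)) (Q.prod ν) := by
    have := (hg.integrable_form k hk').comp_snd Q
    simpa only [p] using this
  -- Here `s` alone need not be integrable against `h`, so `e^{-ky}` is inserted. With `a = e^{-y}`,
  -- the mean of `|a^k - 1_{M ≤ a}|` is `2 a^k (1 - a^k) ≤ 2 k a (1 - a)` by Bernoulli, again the
  -- weight.
  have i2 : Integrable (fun q : Ω × ℝ => h q.2 *
      (Real.exp (-q.2) ^ k - if M q.1 ≤ Real.exp (-q.2) then 1 else 0)) (Q.prod ν) := by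
    rw [integrable_prod_iff' (by fun_prop)]
    constructor
    · refine Filter.Eventually.of_forall fun y => ?_
      exact Integrable.const_mul (f := fun ω => Real.exp (-y) ^ k -
        if M ω ≤ Real.exp (-y) then (1 : ℝ) else 0) ((integrable_const _).sub (hIint y)) (h y)
    · refine (hg.integrable_weight.const_mul (2 * k)).mono' ?_ ?_
      · exact (StronglyMeasurable.integral_prod_left (f := fun ω y => ‖h y *
          (Real.exp (-y) ^ k - if M ω ≤ Real.exp (-y) then 1 else 0)‖)
          (Measurable.stronglyMeasurable (by fun_prop))).aestronglyMeasurable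
      filter_upwards [ae_restrict_mem measurableSet_Ioi] with y hy
      have hy : 0 < y := hy
      have a0 := Real.exp_pos (-y)
      have a1 := exp_neg_lt_one hy
      have hy0 := hg.nonneg y hy
      have hIy := hI y hy
      have hIi := hIint y
      change ‖∫ ω, ‖h y * (Real.exp (-y) ^ k - if M ω ≤ Real.exp (-y) then 1 else 0)‖ ∂Q‖ ≤
        2 * k * (h y * Real.exp (-y) * (1 - Real.exp (-y)))
      set a := Real.exp (-y)
      have b0 : 0 ≤ a ^ k := by positivity
      have b1 : a ^ k ≤ a := pow_le_of_le_one a0.le a1.le (by omega)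
      have b2 : 1 - a ^ k ≤ k * (1 - a) := by
        have := one_add_mul_sub_le_pow (a := a) (by linarith) k
        linarith
      have e : ∀ ω, ‖h y * (a ^ k - if M ω ≤ a then (1 : ℝ) else 0)‖ =
          h y * (a ^ k + (1 - 2 * a ^ k) * if M ω ≤ a then (1 : ℝ) else 0) := fun ω => by
        rw [norm_mul, Real.norm_of_nonneg hy0, Real.norm_eq_abs]
        split_ifs
        · rw [abs_of_nonpos (by linarith)]; ring
        · rw [sub_zero, abs_of_nonneg b0]; ring
      simp_rw [e]
      rw [integral_const_mul, integral_add (integrable_const _) (hIi.const_mul _),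
        integral_const_mul, hIy]
      simp only [integral_const, probReal_univ, one_smul]
      have c0 : 0 ≤ a ^ k * (1 - a ^ k) := mul_nonneg b0 (by linarith)
      have c1 : a ^ k * (1 - a ^ k) ≤ a * (k * (1 - a)) :=
        mul_le_mul b1 b2 (by linarith) a0.le
      rw [show a ^ k + (1 - 2 * a ^ k) * a ^ k = 2 * (a ^ k * (1 - a ^ k)) by ring,
        Real.norm_of_nonneg (by positivity)]
      have := mul_le_mul_of_nonneg_left c1 hy0
      linarith
  have i3 : Integrable (Function.uncurry fun (ω : Ω) (y : ℝ) =>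
      h y * (s y - if M ω ≤ Real.exp (-y) then 1 else 0)) (Q.prod ν) := by
    refine (i1.add i2).congr (Filter.Eventually.of_forall fun q => ?_)
    simp only [Pi.add_apply, Function.uncurry]
    ring
  refine ⟨i3.integral_prod_left, ?_⟩
  unfold quantileForm
  rw [integral_integral_swap i3, hg.eq_integral k hk']
  refine setIntegral_congr_fun measurableSet_Ioi fun y hy => ?_
  rw [integral_const_mul, integral_sub (integrable_const _) (hIint y), hI y hy, p]
  simp

lemma quantileForm_ciSup (hg : IsIntegralForm g s h) (hh : Measurable h) (hs : Measurable s)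
    {k : ℕ} [NeZero k] (x : Fin k → ℝ) (hx : ∀ i, x i ∈ Set.Ioo (0 : ℝ) 1) :
    ⨆ i, quantileForm s h (x i) = quantileForm s h (⨆ i, x i) := by
  obtain ⟨j, hj⟩ := exists_eq_ciSup_of_finite (f := x)
  have hmono := hg.monotoneOn_quantileForm hh hs
  rw [← hj]
  apply le_antisymm
  · refine ciSup_le fun i => hmono (hx i) (hx j) ?_
    rw [hj]
    exact le_ciSup (Set.finite_range x).bddAbove i
  · exact le_ciSup (f := fun i => quantileForm s h (x i)) (Set.finite_range _).bddAbove j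

end IsIntegralForm

lemma volume_real_Ioo_inter_Iic {a : ℝ} (ha : a ∈ Set.Ioo (0 : ℝ) 1) :
    (volume.restrict (Set.Ioo (0 : ℝ) 1)).real (Set.Iic a) = a := by
  rw [measureReal_restrict_apply measurableSet_Iic,
    show Set.Iic a ∩ Set.Ioo (0 : ℝ) 1 = Set.Ioc 0 a by
      ext x
      simp only [Set.mem_inter_iff, Set.mem_Iic, Set.mem_Ioo, Set.mem_Ioc]
      constructor
      · rintro ⟨h1, h2, h3⟩; exact ⟨h2, h1⟩
      · rintro ⟨h1, h2⟩; exact ⟨h2, h1, h2.trans_lt ha.2⟩]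
  simp [ha.1.le]

instance isProbabilityMeasure_uniform_Ioo :
    IsProbabilityMeasure (volume.restrict (Set.Ioo (0 : ℝ) 1)) :=
  ⟨by simp⟩

namespace IsIntegralForm

variable {g s h : ℝ → ℝ}

lemma integrable_quantileForm (hg : IsIntegralForm g s h) (hh : Measurable h) :
    Integrable (quantileForm s h) (volume.restrict (Set.Ioo (0 : ℝ) 1)) :=
  (hg.integral_quantileForm_comp hh _ (fun u => u) measurable_id 1 le_rfl fun a ha => by
    rw [pow_one]; exact volume_real_Ioo_inter_Iic ha).1

/-- Monotonicity moves the maximum inside `quantileForm`, and the maximum of `k` independent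
uniforms has distribution function `a ^ k`. -/
lemma expectedMax_quantileForm (hg : IsIntegralForm g s h) (hh : Measurable h)
    (hs : Measurable s) (k : ℕ) (hk : 1 ≤ k) :
    expectedMax (volume.restrict (Set.Ioo (0 : ℝ) 1)) (quantileForm s h) k = g k := by
  set P := volume.restrict (Set.Ioo (0 : ℝ) 1) with hP
  have : NeZero k := ⟨by omega⟩
  have hX := measurable_quantileForm hh hs
  have : IsProbabilityMeasure (P.map (quantileForm s h)) :=
    Measure.isProbabilityMeasure_map hX.aemeasurable
  have hmp : MeasurePreserving (fun (x : Fin k → ℝ) i => quantileForm s h (x i))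
      (Measure.pi fun _ => P) (Measure.pi fun _ => P.map (quantileForm s h)) :=
    measurePreserving_pi (fun _ : Fin k => P) _ fun _ => ⟨hX, rfl⟩
  have hmS : Measurable fun x : Fin k → ℝ => ⨆ i, x i :=
    Measurable.iSup fun i => measurable_pi_apply i
  rw [expectedMax, iidLaw, ← hmp.map_eq, integral_map hmp.measurable.aemeasurable
    hmS.aestronglyMeasurable, ← (hg.integral_quantileForm_comp hh (Measure.pi fun _ => P)
      (fun x : Fin k → ℝ => ⨆ i, x i) hmS k hk _).2]
  · refine integral_congr_ae ?_
    have hall : ∀ᵐ x ∂(Measure.pi fun _ : Fin k => P), ∀ i, x i ∈ Set.Ioo (0 : ℝ) 1 :=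
      ae_all_iff.2 fun i => (measurePreserving_eval (fun _ : Fin k => P) i).quasiMeasurePreserving.ae
        (ae_restrict_mem measurableSet_Ioo)
    filter_upwards [hall] with x hx
    exact hg.quantileForm_ciSup hh hs x hx
  · intro a ha
    have e : {x : Fin k → ℝ | ⨆ i, x i ≤ a} = Set.univ.pi fun _ => Set.Iic a := by
      ext x
      simp [ciSup_le_iff (Set.finite_range x).bddAbove, Pi.le_def]
    have hv := volume_real_Ioo_inter_Iic ha
    rw [← hP] at hv
    rw [e, Measure.real, Measure.pi_pi]
    simp only [Finset.prod_const, Finset.card_univ, Fintype.card_fin, ENNReal.toReal_pow]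
    rw [← Measure.real, hv]

/-- A constant variable has constant expected maxima, but positivity of the weight integral gives `g
1 < g 2`. -/
lemma quantileForm_not_ae_const (hg : IsIntegralForm g s h) (hh : Measurable h)
    (hs : Measurable s) :
    ¬ ∃ c : ℝ, ∀ᵐ u ∂(volume.restrict (Set.Ioo (0 : ℝ) 1)), quantileForm s h u = c := by
  rintro ⟨c, hc⟩
  have hlt : g 1 < g 2 := by
    have h0 := hg.sub_eq_integral 0
    have h1 := hg.weight_pos
    simp only [pow_zero, mul_one] at h0
    rw [← h0] at h1
    norm_num at h1
    exact h1
  have hmax : ∀ k : ℕ, 1 ≤ k → g k = c := fun k hk => by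
    have : NeZero k := ⟨by omega⟩
    rw [← hg.expectedMax_quantileForm hh hs k hk, expectedMax, iidLaw,
      show (volume.restrict (Set.Ioo (0 : ℝ) 1)).map (quantileForm s h) = Measure.dirac c by
        rw [Measure.map_congr hc, Measure.map_const]; simp]
    have hall : ∀ᵐ x ∂(Measure.pi fun _ : Fin k => Measure.dirac c), ∀ i, x i = c :=
      ae_all_iff.2 fun i => (measurePreserving_eval
        (fun _ : Fin k => Measure.dirac c) i).quasiMeasurePreserving.ae (p := fun z => z = c)
          (by simp [ae_dirac_eq])
    rw [integral_congr_ae (g := fun _ => c) (hall.mono fun x hx => by simp [hx])]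
    simp
  have h1 := hmax 1 le_rfl
  have h2 := hmax 2 (by norm_num)
  norm_num at h1 h2
  linarith

end IsIntegralForm

/-! ### Symmetry of the constructed variable under (*) -/

namespace IsIntegralForm

variable {g s h : ℝ → ℝ}

lemma map_expReflect_eq
    (hsymm : ∀ᵐ y ∂(volume.restrict (Set.Ioi (0 : ℝ))),
      h (-Real.log (1 - Real.exp (-y))) = (Real.exp y - 1) * h y) :
    ((volume.restrict (Set.Ioi (0 : ℝ))).withDensity fun y => ENNReal.ofReal (h y)).map expReflect =
      (volume.restrict (Set.Ioi (0 : ℝ))).withDensity fun y => ENNReal.ofReal (h y) := by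
  rw [map_expReflect_withDensity]
  refine withDensity_congr_ae ?_
  filter_upwards [hsymm, ae_restrict_mem measurableSet_Ioi] with y hy hy0
  have hy0 : 0 < y := hy0
  have h3 : 0 < Real.exp y - 1 := by linarith [Real.add_one_lt_exp hy0.ne']
  rw [expReflect, hy, ← ENNReal.ofReal_mul (inv_pos.2 h3).le, inv_mul_cancel_left₀ h3.ne']

lemma integral_comp_expReflect (hg : IsIntegralForm g s h) (hh : Measurable h)
    (hsymm : ∀ᵐ y ∂(volume.restrict (Set.Ioi (0 : ℝ))),
      h (-Real.log (1 - Real.exp (-y))) = (Real.exp y - 1) * h y)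
    (f : ℝ → ℝ) (hf : Measurable f) :
    ∫ y in Set.Ioi (0 : ℝ), h y * f (expReflect y) = ∫ y in Set.Ioi (0 : ℝ), h y * f y := by
  have key : ∀ f : ℝ → ℝ, ∫ y in Set.Ioi (0 : ℝ), h y * f y =
      ∫ y, f y ∂((volume.restrict (Set.Ioi (0 : ℝ))).withDensity fun y => ENNReal.ofReal (h y)) := by
    intro f
    rw [integral_withDensity_eq_integral_toReal_smul (by fun_prop) (by simp)]
    refine setIntegral_congr_fun measurableSet_Ioi fun y hy => ?_
    simp only [smul_eq_mul]
    rw [ENNReal.toReal_ofReal (hg.nonneg y hy)]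
  rw [key, key f]
  conv_rhs => rw [← map_expReflect_eq hsymm]
  rw [integral_map measurable_expReflect.aemeasurable hf.aestronglyMeasurable]

lemma quantileForm_sub (hg : IsIntegralForm g s h) (hh : Measurable h)
    (hs : Measurable s) {u v : ℝ} (hu : u ∈ Set.Ioo (0 : ℝ) 1) (hv : v ∈ Set.Ioo (0 : ℝ) 1) :
    quantileForm s h u - quantileForm s h v = ∫ y in Set.Ioi (0 : ℝ), h y *
      ((if v ≤ Real.exp (-y) then 1 else 0) - if u ≤ Real.exp (-y) then 1 else 0) := by
  rw [quantileForm, quantileForm, ← integral_sub (hg.integrable_quantile_integrand hh hs hu)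
    (hg.integrable_quantile_integrand hh hs hv)]
  congr 1
  ext y
  ring

/-- In differences of `quantileForm` the possibly non-symmetric `s` disappears; invariance of `h y
dy` then turns the difference between `u` and `1/2` into that between `1/2` and `1 - u`. -/
lemma quantileForm_add_reflect (hg : IsIntegralForm g s h) (hh : Measurable h)
    (hs : Measurable s)
    (hsymm : ∀ᵐ y ∂(volume.restrict (Set.Ioi (0 : ℝ))),
      h (-Real.log (1 - Real.exp (-y))) = (Real.exp y - 1) * h y)
    {u : ℝ} (hu : u ∈ Set.Ioo (0 : ℝ) 1) :
    quantileForm s h u + quantileForm s h (1 - u) = 2 * quantileForm s h 2⁻¹ := by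
  have hhalf : (2⁻¹ : ℝ) ∈ Set.Ioo (0 : ℝ) 1 := by constructor <;> norm_num
  have hu' : 1 - u ∈ Set.Ioo (0 : ℝ) 1 := ⟨by linarith [hu.2], by linarith [hu.1]⟩
  have hm : ∀ a : ℝ, Measurable fun y : ℝ => if a ≤ Real.exp (-y) then (1 : ℝ) else 0 := fun a =>
    Measurable.ite (measurableSet_le measurable_const (by fun_prop)) measurable_const
      measurable_const
  -- Excludes the ties at which `u ≤ 1 - e^{-y}` and `1 - u ≤ e^{-y}` both hold.
  have hne : ∀ a : ℝ, ∀ᵐ y ∂(volume.restrict (Set.Ioi (0 : ℝ))), Real.exp (-y) ≠ a := fun a => by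
    refine ae_restrict_of_ae ((Set.Countable.ae_notMem (Set.countable_singleton (-Real.log a))
      volume).mono fun y hy h => hy ?_)
    rw [Set.mem_singleton_iff, ← h, Real.log_exp, neg_neg]
  have h1 := (hg.quantileForm_sub hh hs hu hhalf).trans (hg.integral_comp_expReflect hh hsymm
    (fun y => (if 2⁻¹ ≤ Real.exp (-y) then 1 else 0) - if u ≤ Real.exp (-y) then 1 else 0)
    ((hm _).sub (hm _))).symm
  have h2 := hg.quantileForm_sub hh hs hhalf hu'
  have h3 : quantileForm s h u - quantileForm s h 2⁻¹ =
      quantileForm s h 2⁻¹ - quantileForm s h (1 - u) := by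
    rw [h1, h2]
    refine integral_congr_ae ?_
    filter_upwards [ae_restrict_mem measurableSet_Ioi, hne 2⁻¹, hne (1 - u)] with y hy n1 n2
    rw [exp_neg_expReflect hy]
    set a := Real.exp (-y)
    have c1 : 2⁻¹ ≤ 1 - a ↔ ¬ 2⁻¹ ≤ a := by
      constructor
      · intro h h'
        exact n1 (by linarith)
      · intro h
        linarith
    have c2 : u ≤ 1 - a ↔ ¬ 1 - u ≤ a := by
      constructor
      · intro h h'
        exact n2 (by linarith)
      · intro h
        linarith
    simp only [c1, c2]
    by_cases d1 : 2⁻¹ ≤ a <;> by_cases d2 : 1 - u ≤ a <;> simp [d1, d2]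
  linarith

lemma isSymmetricEMS_of_measurable (hg : IsIntegralForm g s h) (hh : Measurable h)
    (hs : Measurable s)
    (hsymm : ∀ᵐ y ∂(volume.restrict (Set.Ioi (0 : ℝ))),
      h (-Real.log (1 - Real.exp (-y))) = (Real.exp y - 1) * h y) :
    IsSymmetricEMS (fun k : ℕ => g k) := by
  have hX := measurable_quantileForm hh hs
  have hXi := hg.integrable_quantileForm hh
  refine ⟨ℝ, inferInstance, volume.restrict (Set.Ioo 0 1), quantileForm s h,
    ⟨inferInstance, hX, hXi, hg.quantileForm_not_ae_const hh hs⟩, ?_,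
    fun k hk => hg.expectedMax_quantileForm hh hs k hk⟩
  set P := volume.restrict (Set.Ioo (0 : ℝ) 1) with hP
  have hmp : MeasurePreserving (fun u : ℝ => 1 - u) P P := by
    have := (Measure.measurePreserving_sub_left volume (1 : ℝ)).restrict_preimage
      (measurableSet_Ioo (a := (0 : ℝ)) (b := 1))
    have e : (fun u : ℝ => 1 - u) ⁻¹' Set.Ioo 0 1 = Set.Ioo 0 1 := by
      ext u
      simp only [Set.mem_preimage, Set.mem_Ioo]
      constructor <;> rintro ⟨h1, h2⟩ <;> constructor <;> linarith
    rwa [e] at this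
  have hsum : ∀ᵐ u ∂P, quantileForm s h (1 - u) = 2 * quantileForm s h 2⁻¹ - quantileForm s h u := by
    filter_upwards [ae_restrict_mem measurableSet_Ioo] with u hu
    linarith [hg.quantileForm_add_reflect hh hs hsymm hu]
  -- Averaging the reflection identity identifies the mean with the median value `q (1/2)`.
  have hmean : ∫ u, quantileForm s h u ∂P = quantileForm s h 2⁻¹ := by
    have h1 : ∫ u, quantileForm s h (1 - u) ∂P = ∫ u, quantileForm s h u ∂P := by
      conv_rhs => rw [← hmp.map_eq]
      rw [integral_map hmp.measurable.aemeasurable hX.aestronglyMeasurable]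
    rw [integral_congr_ae hsum, integral_sub (integrable_const _) hXi] at h1
    simp only [integral_const, probReal_univ, one_smul] at h1
    linarith
  refine ⟨by fun_prop, by fun_prop, ?_⟩
  rw [hmean]
  have e : (fun u => -(quantileForm s h u - quantileForm s h 2⁻¹)) =ᵐ[P]
      (fun u => quantileForm s h u - quantileForm s h 2⁻¹) ∘ fun u => 1 - u := by
    filter_upwards [hsum] with u hu
    simp only [Function.comp, hu]
    ring
  rw [Measure.map_congr e, ← Measure.map_map (by fun_prop) hmp.measurable, hmp.map_eq]

/-- Extending `h` and `s` by zero off `(0, ∞)` gives globally measurable functions without changing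
any integral or (*). -/
lemma isSymmetricEMS (hg : IsIntegralForm g s h)
    (hsymm : ∀ᵐ y ∂(volume.restrict (Set.Ioi (0 : ℝ))),
      h (-Real.log (1 - Real.exp (-y))) = (Real.exp y - 1) * h y) :
    IsSymmetricEMS (fun k : ℕ => g k) := by
  set h' := (Set.Ioi (0 : ℝ)).indicator h with hh'
  set s' := (Set.Ioi (0 : ℝ)).indicator s with hs'
  have eh : ∀ y : ℝ, 0 < y → h' y = h y := fun y hy => Set.indicator_of_mem (Set.mem_Ioi.2 hy) h
  have es : ∀ y : ℝ, 0 < y → s' y = s y := fun y hy => Set.indicator_of_mem (Set.mem_Ioi.2 hy) s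
  have mh : Measurable h' := measurable_indicator_Ioi hg.measurable_h
  have ms : Measurable s' := measurable_indicator_Ioi hg.measurable_s
  have e1 : Set.EqOn (fun y => h y * Real.exp (-y) * (1 - Real.exp (-y)))
      (fun y => h' y * Real.exp (-y) * (1 - Real.exp (-y))) (Set.Ioi 0) := fun y hy => by
    simp only [eh y hy]
  have e2 : ∀ x : ℝ, Set.EqOn (fun y => h y * (s y - Real.exp (-(x * y))))
      (fun y => h' y * (s' y - Real.exp (-(x * y)))) (Set.Ioi 0) := fun x y hy => by
    simp only [eh y hy, es y hy]
  refine isSymmetricEMS_of_measurable (s := s') (h := h') (g := g)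
    ⟨mh.comp measurable_subtype_coe, ms.comp measurable_subtype_coe,
      fun y hy => (eh y hy).symm ▸ hg.nonneg y hy,
      hg.integrable_weight.congr_fun e1 measurableSet_Ioi, ?_,
      fun x hx => (hg.integrable_form x hx).congr_fun (e2 x) measurableSet_Ioi,
      fun x hx => ?_⟩ mh ms ?_
  · rw [← setIntegral_congr_fun measurableSet_Ioi e1]
    exact hg.weight_pos
  · rw [← setIntegral_congr_fun measurableSet_Ioi (e2 x)]
    exact hg.eq_integral x hx
  · filter_upwards [hsymm, ae_restrict_mem measurableSet_Ioi] with y hy hy0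
    rw [eh y hy0, ← hy]
    exact eh _ (expReflect_pos hy0)

/-! ### Normalizations and conclusion -/

lemma const_mul (hg : IsIntegralForm g s h) {c : ℝ} (hc : 0 < c) :
    IsIntegralForm (fun x => c * g x) s (fun y => c * h y) where
  measurable_h := hg.measurable_h.const_mul c
  measurable_s := hg.measurable_s
  nonneg y hy := mul_nonneg hc.le (hg.nonneg y hy)
  integrable_weight := by
    simpa only [IntegrableOn, mul_assoc] using hg.integrable_weight.const_mul c
  weight_pos := by
    have := mul_pos hc hg.weight_pos
    rw [← integral_const_mul] at this
    simpa only [mul_assoc] using this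
  integrable_form x hx := by
    simpa only [IntegrableOn, mul_assoc] using (hg.integrable_form x hx).const_mul c
  eq_integral x hx := by
    rw [hg.eq_integral x hx, ← integral_const_mul]
    simp only [mul_assoc]

/-- Ranges vanish at `k = 1`; subtracting `g 1` changes only `s`, and (*) involves only `h`. -/
lemma sub_apply_one (hg : IsIntegralForm g s h) :
    IsIntegralForm (fun x => g x - g 1) (fun y => Real.exp (-y)) h := by
  have e : ∀ x : ℝ, (fun y => h y * (Real.exp (-y) - Real.exp (-(x * y)))) =
      fun y => h y * (s y - Real.exp (-(x * y))) - h y * (s y - Real.exp (-(1 * y))) := fun x => by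
    ext y
    rw [one_mul]
    ring
  refine ⟨hg.measurable_h, by fun_prop, hg.nonneg, hg.integrable_weight, hg.weight_pos,
    fun x hx => ?_, fun x hx => ?_⟩
  · rw [e x]
    exact (hg.integrable_form x hx).sub (hg.integrable_form 1 le_rfl)
  · rw [e x, integral_sub (hg.integrable_form x hx) (hg.integrable_form 1 le_rfl),
      ← hg.eq_integral x hx, ← hg.eq_integral 1 le_rfl]

end IsIntegralForm

theorem corollary4p2 (g s h₁ : ℝ → ℝ) (hg : IsIntegralForm g s h₁) :
    (IsSymmetricEMS (fun k : ℕ => g k) ↔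
      ∀ᵐ y ∂(volume.restrict (Set.Ioi (0 : ℝ))),
        h₁ (-Real.log (1 - Real.exp (-y))) = (Real.exp y - 1) * h₁ y) ∧
    (IsNondegenerateERS (fun k : ℕ => g k) ↔
      g 1 = 0 ∧
      ∀ᵐ y ∂(volume.restrict (Set.Ioi (0 : ℝ))),
        h₁ (-Real.log (1 - Real.exp (-y))) = (Real.exp y - 1) * h₁ y) := by
  refine ⟨⟨fun hE => ?_, hg.isSymmetricEMS⟩, fun hR => ⟨?_, hg.ae_eq_of_isNondegenerateERS hR⟩,
    fun ⟨h1, hsymm⟩ => ?_⟩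
  -- The ranges are `2 (g k - g 1)`, with weight `2 h₁`; (*) is homogeneous, so the `2` drops out.
  · have hR := hE.isNondegenerateERS
    simp only [Nat.cast_one] at hR
    filter_upwards [(hg.sub_apply_one.const_mul two_pos).ae_eq_of_isNondegenerateERS hR] with y hy
    linarith
  · simpa using hR.apply_one
  -- A symmetric variable with maxima `g k / 2` has ranges `g k - g 1 = g k`.
  · have hE := (hg.const_mul (c := 2⁻¹) (by norm_num)).isSymmetricEMS (hsymm.mono fun y hy => by
      simp only [hy]; ring)
    have hR := hE.isNondegenerateERS
    simpa [h1] using hR
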